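/- **Conventions.** All topological spaces are $\Delta$-generated, $k_\Delta$ denotes the $\Delta$-kelleyfication, and $I=[0,1]$. Let $\mathcal I$ be the set of nondecreasing continuous maps $I\to I$, $\mathcal M\subset\mathcal I$ the surjective ones, and $\mathcal I^-=\{\phi\in\mathcal I\mid \phi(0)=0,\ \phi(]0,1[)\cap\{0,1\}=\varnothing\}$. A *multipointed $d$-space* $X$ consists of a space $|X|$, a subset $X^0\subset|X|$ of states and a set of continuous maps $I\to|X|$, the execution paths, whose endpoints are states and which is closed under precomposition by elements of $\mathcal M$ and under normalized composition $*_N$. A map $f:X\to Y$ of multipointed $d$-spaces is a continuous map $|f|:|X|\to|Y|$ which takes states to states and execution paths to execution paths. A *directed path* of $X$ is a constant path or a path $\gamma:I\to|X|$ for which there are $0=a_0<a_1<\dots<a_m=1$, $m\geqslant 1$, such that on each $[a_{i-1},a_i]$ one has $\gamma(t)=e_i\phi_i\big((t-a_{i-1})/(a_i-a_{i-1})\big)$ with $e_i$ an execution path and $\phi_i\in\mathcal I$. For $\alpha\in X^0$, let $\mathcal P^-_\alpha(X)$ be the set of *short* directed paths from $\alpha$, i.e. directed paths $\gamma$ with $\gamma(0)=\alpha$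 and $\gamma(]0,1[)\cap X^0=\varnothing$, equipped with the $\Delta$-kelleyfication of the topology induced by the compact-open topology. The *branching space* $\mathcal G^-_\alpha(X)$ is the quotient of $\mathcal P^-_\alpha(X)$, with the quotient topology, by the equivalence relation generated by $\gamma\phi_1\sim\gamma\phi_2$ for $\gamma\in\mathcal P^-_\alpha(X)$ and $\phi_1,\phi_2\in\mathcal I^-$; the class of $\gamma$ is denoted by $\langle\gamma\rangle$. The *topological globe* $\mathrm{Glob}^{top}(Z)$ of a space $Z$ has underlying space the quotient of $\{0,1\}\sqcup(Z\times I)$ by $(z,0)=0$, $(z,1)=1$, the set of states $\{0,1\}$, and the execution paths $\delta_z\phi$ with $z\in Z$, $\phi\in\mathcal M$, where $\delta_z(t)=(z,t)$. For $F\subset|\mathrm{Glob}^{top}(Z)|$, let $\mathrm{Glob}^{top}(Z)_F$ have the same underlying space, the set of states $\{0,1\}\cup F$, and, as execution paths, the directed paths of $\mathrm{Glob}^{top}(Z)$ from one element of $\{0,1\}\cup F$ to a different one. Let $\mathbf D^n$ be the closed unit ball of $\mathbb R^n$ and $\mathbf S^{n-1}$ its boundary sphere ($\mathbf S^{-1}=\varnothing$).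 A multipointed $d$-space $A$ is *cellular* if, for some set $S$, it is the colimit of a colimit-preserving well-ordered tower that starts at $(S,S,\varnothing)$ and whose successive maps are pushouts of maps $\mathrm{Glob}^{top}(\mathbf S^{n-1})\subset\mathrm{Glob}^{top}(\mathbf D^n)$, $n\geqslant 0$. **Proposition.** Let $n\geqslant 0$, and let $F$ be a finite subset of $|\mathrm{Glob}^{top}(\mathbf D^n)|\setminus|\mathrm{Glob}^{top}(\mathbf S^{n-1})|$. Let $A$ be a cellular multipointed $d$-space, let $g:\mathrm{Glob}^{top}(\mathbf D^n)\to A$ be a map of multipointed $d$-spaces, and let $$\begin{array}{ccc}\mathrm{Glob}^{top}(\mathbf D^n)&\xrightarrow{\ g\ }&A\\ \downarrow&&\downarrow f\\ \mathrm{Glob}^{top}(\mathbf D^n)_F&\xrightarrow{\ \widehat g\ }&X\end{array}$$ be a pushout square of multipointed $d$-spaces whose left vertical map is the identity on underlying spaces. Let $\alpha\in A^0$. Then the mapping $\gamma\mapsto f\gamma$ induces a homeomorphism $\mathcal G^-_\alpha(A)\cong\mathcal G^-_{f(\alpha)}(X)$, in the following sense: for every $\gamma\in\mathcal P^-_\alpha(A)$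 there is $\phi\in\mathcal I^-$ such that $\gamma\phi\in\mathcal P^-_\alpha(A)$ and $f\gamma\phi\in\mathcal P^-_{f(\alpha)}(X)$ (so that $\langle\gamma\rangle=\langle\gamma\phi\rangle$), and there is exactly one homeomorphism $H:\mathcal G^-_\alpha(A)\to\mathcal G^-_{f(\alpha)}(X)$ such that $H\langle\gamma\rangle=\langle f\gamma\rangle$ for all $\gamma\in\mathcal P^-_\alpha(A)$ with $f\gamma\in\mathcal P^-_{f(\alpha)}(X)$. -/

import Mathlib

open CategoryTheory Topology unitInterval

universe u

namespace DirTop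

/-! ## Reparametrizations and compositions of paths -/

/-- The `Δ`-kelleyfication of a topological space `Y`: the same set, with the topology generated
by the continuous maps from the Euclidean spaces to `Y`. -/
abbrev KDelta (Y : Type*) [TopologicalSpace Y] : Type _ :=
  WithGeneratedByTopology (fun n : ℕ => Fin n → ℝ) Y

instance deltaGenerated_of_discrete {Y : Type*} [TopologicalSpace Y] [DiscreteTopology Y] :
    DeltaGeneratedSpace Y := by
  refine IsGeneratedBy.iff_le_generatedBy.2 ?_
  rw [DiscreteTopology.eq_bot (α := Y)]
  exact bot_le

instance deltaGenerated_unitInterval : DeltaGeneratedSpace I := by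
  have hc : Continuous (fun v : Fin 1 → ℝ => Set.projIcc (0 : ℝ) 1 zero_le_one (v 0)) :=
    continuous_projIcc.comp (continuous_apply 0)
  have hs : Continuous (fun t : I => (fun _ => (t : ℝ) : Fin 1 → ℝ)) :=
    continuous_pi fun _ => continuous_subtype_val
  exact (IsQuotientMap.of_inverse hs hc
    (fun t => Set.projIcc_val zero_le_one t)).isGeneratedBy (X := fun n : ℕ => Fin n → ℝ)

/-- Nondecreasing continuous maps from `[0,1]` to itself (the set `𝓘`). -/
def IsReparam (φ : C(I, I)) : Prop := Monotone φ

/-- Nondecreasing surjective maps from `[0,1]` to itself (the set `𝓜`). -/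
def IsSurjReparam (φ : C(I, I)) : Prop := Monotone φ ∧ Function.Surjective φ

/-- The set `𝓘⁻` of the nondecreasing continuous `φ : [0,1] → [0,1]` with `φ 0 = 0` and
`φ (]0,1[) ∩ {0,1} = ∅`. -/
def IsStartReparam (φ : C(I, I)) : Prop :=
  IsReparam φ ∧ φ 0 = 0 ∧ ∀ t : I, 0 < t → t < 1 → φ t ≠ 0 ∧ φ t ≠ 1

/-- The normalized composition `γ₁ *_N γ₂` of two paths with `γ₁ 1 = γ₂ 0`. -/
noncomputable def normComp {U : Type*} [TopologicalSpace U] (γ₁ γ₂ : C(I, U))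
    (h : γ₁ 1 = γ₂ 0) : C(I, U) :=
  (Path.trans (⟨γ₁, rfl, rfl⟩ : Path (γ₁ 0) (γ₁ 1))
    (⟨γ₂, h.symm, rfl⟩ : Path (γ₁ 1) (γ₂ 1))).toContinuousMap

/-- The affine map `u ↦ a + u (b - a)` from `[0,1]` to `[a,b] ⊆ [0,1]`. -/
noncomputable def seg (a b : I) : C(I, I) :=
  ⟨Set.Icc.convexComb a b, Set.Icc.continuous_convexComb a b⟩

theorem IsSurjReparam.map_zero {φ : C(I, I)} (h : IsSurjReparam φ) : φ 0 = 0 := by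
  obtain ⟨t, ht⟩ := h.2 0
  exact le_antisymm ((h.1 (show (0 : I) ≤ t from t.2.1)).trans_eq ht) (φ 0).2.1

theorem IsSurjReparam.map_one {φ : C(I, I)} (h : IsSurjReparam φ) : φ 1 = 1 := by
  obtain ⟨t, ht⟩ := h.2 1
  exact le_antisymm (φ 1).2.2 (ht.symm.trans_le (h.1 (show t ≤ (1 : I) from t.2.2)))

theorem seg_zero_one : seg 0 1 = ContinuousMap.id I := by
  ext t
  exact congrArg Subtype.val (Set.Icc.convexComb_zero_one t)

/-- The inverse of `seg a b` on `[a,b]`. -/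
noncomputable def segInv (a b : I) : C(I, I) :=
  ⟨fun t => Set.projIcc 0 1 zero_le_one (((t : ℝ) - a) / (b - a)),
    continuous_projIcc.comp (by fun_prop)⟩

theorem segInv_mono {a b : I} (h : a < b) : Monotone (segInv a b) := by
  intro s t hst
  refine Set.monotone_projIcc zero_le_one ?_
  have h' : (0 : ℝ) < b - a := sub_pos.2 h
  have : (s : ℝ) ≤ t := hst
  gcongr

theorem seg_segInv {a b : I} (h : a < b) {t : I} (h1 : a ≤ t) (h2 : t ≤ b) :
    seg a b (segInv a b t) = t := by
  have h' : (0 : ℝ) < b - a := sub_pos.2 h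
  have h1' : (a : ℝ) ≤ t := h1
  have h2' : (t : ℝ) ≤ b := h2
  have hm : ((t : ℝ) - a) / (b - a) ∈ Set.Icc (0 : ℝ) 1 :=
    ⟨div_nonneg (by linarith) h'.le, (div_le_one h').2 (by linarith)⟩
  ext
  change (Set.Icc.convexComb a b (Set.projIcc 0 1 zero_le_one _) : ℝ) = t
  rw [Set.projIcc_of_mem _ hm, Set.Icc.coe_convexComb]
  field_simp
  ring

theorem seg_mono {a b : I} (h : a ≤ b) : Monotone (seg a b) := by
  intro s t hst
  have h' : (a : ℝ) ≤ b := h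
  have hst' : (s : ℝ) ≤ t := hst
  change (Set.Icc.convexComb a b s : ℝ) ≤ Set.Icc.convexComb a b t
  rw [Set.Icc.coe_convexComb, Set.Icc.coe_convexComb]
  nlinarith [mul_nonneg (sub_nonneg.2 h') (sub_nonneg.2 hst')]

@[simp] theorem seg_zero (a b : I) : seg a b 0 = a := Set.Icc.convexComb_zero a b

@[simp] theorem seg_one (a b : I) : seg a b 1 = b := Set.Icc.convexComb_one a b

/-- The affine bijection from `[0,1]` to `[0,1/2]`. -/
noncomputable def lowerHalf : C(I, I) := seg 0 ⟨1 / 2, by norm_num, by norm_num⟩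

/-- The affine bijection from `[0,1]` to `[1/2,1]`. -/
noncomputable def upperHalf : C(I, I) := seg ⟨1 / 2, by norm_num, by norm_num⟩ 1

theorem coe_lowerHalf (t : I) : (lowerHalf t : ℝ) = t / 2 := by
  change (Set.Icc.convexComb _ _ t : ℝ) = _
  rw [Set.Icc.coe_convexComb]
  simp
  ring

theorem coe_upperHalf (t : I) : (upperHalf t : ℝ) = (1 + t) / 2 := by
  change (Set.Icc.convexComb _ _ t : ℝ) = _
  rw [Set.Icc.coe_convexComb]
  simp
  ring

theorem normComp_lowerHalf {U : Type*} [TopologicalSpace U] (γ₁ γ₂ : C(I, U))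
    (h : γ₁ 1 = γ₂ 0) : (normComp γ₁ γ₂ h).comp lowerHalf = γ₁ := by
  ext t
  change (Path.trans _ _) (lowerHalf t) = _
  have ht : ((lowerHalf t : I) : ℝ) ≤ 1 / 2 := by
    rw [coe_lowerHalf]; linarith [t.2.2]
  rw [Path.trans_apply, dif_pos ht]
  change γ₁ _ = γ₁ t
  congr 1
  ext
  simp [coe_lowerHalf]
  ring

theorem normComp_upperHalf {U : Type*} [TopologicalSpace U] (γ₁ γ₂ : C(I, U))
    (h : γ₁ 1 = γ₂ 0) : (normComp γ₁ γ₂ h).comp upperHalf = γ₂ := by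
  ext t
  change (Path.trans _ _) (upperHalf t) = _
  by_cases ht : ((upperHalf t : I) : ℝ) ≤ 1 / 2
  · have ht0 : (t : ℝ) = 0 := by
      rw [coe_upperHalf] at ht; linarith [t.2.1]
    rw [Path.trans_apply, dif_pos ht]
    have e : t = 0 := Subtype.ext ht0
    subst e
    change γ₁ _ = γ₂ 0
    rw [← h]
    congr 1
    ext
    simp [coe_upperHalf]
  · rw [Path.trans_apply, dif_neg ht]
    change γ₂ _ = γ₂ t
    congr 1
    ext
    simp [coe_upperHalf]
    ring

theorem seg_comp_affine (c d a b : I) :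
    seg (seg c d a) (seg c d b) = (seg c d).comp (seg a b) := by
  ext t
  change (Set.Icc.convexComb (Set.Icc.convexComb c d a) (Set.Icc.convexComb c d b) t : ℝ)
    = Set.Icc.convexComb c d (Set.Icc.convexComb a b t)
  simp only [Set.Icc.coe_convexComb]
  ring

/-! ## Multipointed d-spaces -/

/-- A multipointed `d`-space: a `Δ`-generated space with a set of states and a set of execution
paths. -/
structure MdTop : Type (u + 1) where
  /-- the underlying set of the underlying space -/
  carrier : Type u
  [top : TopologicalSpace carrier]
  [dgen : DeltaGeneratedSpace carrier]
  /-- the set of states -/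
  states : Set carrier
  /-- the set of execution paths -/
  paths : Set C(I, carrier)
  source_mem : ∀ γ ∈ paths, γ 0 ∈ states
  target_mem : ∀ γ ∈ paths, γ 1 ∈ states
  comp_mem : ∀ γ ∈ paths, ∀ φ : C(I, I), IsSurjReparam φ → γ.comp φ ∈ paths
  normComp_mem : ∀ γ₁ ∈ paths, ∀ γ₂ ∈ paths, ∀ h : γ₁ 1 = γ₂ 0, normComp γ₁ γ₂ h ∈ paths

namespace MdTop

attribute [instance] MdTop.top MdTop.dgen

/-- A map of multipointed `d`-spaces. -/
@[ext]
structure Hom (X Y : MdTop.{u}) : Type u where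
  /-- the underlying continuous map -/
  toMap : C(X.carrier, Y.carrier)
  map_states : ∀ x ∈ X.states, toMap x ∈ Y.states
  map_paths : ∀ γ ∈ X.paths, toMap.comp γ ∈ Y.paths

instance : Category MdTop.{u} where
  Hom := Hom
  id X := ⟨ContinuousMap.id _, fun _ h => h, fun _ h => h⟩
  comp f g := ⟨g.toMap.comp f.toMap, fun x hx => g.map_states _ (f.map_states x hx),
    fun γ hγ => g.map_paths _ (f.map_paths γ hγ)⟩

/-- A set `S`, viewed as the multipointed `d`-space `(S, S, ∅)`. -/
def ofSet (S : Type u) : MdTop.{u} :=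
  letI : TopologicalSpace S := ⊥
  haveI : DiscreteTopology S := ⟨rfl⟩
  { carrier := S
    states := Set.univ
    paths := ∅
    source_mem := fun _ h => h.elim
    target_mem := fun _ h => h.elim
    comp_mem := fun _ h => h.elim
    normComp_mem := fun _ h => h.elim }

/-! ## Directed paths -/

/-- On `[a,b]` with `a < b`, the path `γ` is of the form `e φ μ`, with `e` an execution path,
`φ ∈ 𝓘` and `μ` the affine bijection from `[a,b]` to `[0,1]`. -/
def IsPiece (X : MdTop.{u}) (γ : C(I, X.carrier)) (a b : I) : Prop :=
  a < b ∧ ∃ e ∈ X.paths, ∃ φ : C(I, I), IsReparam φ ∧ γ.comp (seg a b) = e.comp φ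

/-- A directed path of `X` (that is, of the directed space generated by `X`): a constant path, or
a Moore composition `(e₁ φ₁ μ₁) * ⋯ * (eₙ φₙ μₙ)`, `n ≥ 1`, of pieces as in `IsPiece` along a
subdivision `0 = a₀ < a₁ < ⋯ < aₙ = 1`. -/
def IsDirected (X : MdTop.{u}) (γ : C(I, X.carrier)) : Prop :=
  (∃ x, γ = ContinuousMap.const I x) ∨ Relation.TransGen (X.IsPiece γ) 0 1

theorem IsPiece.affine {X : MdTop.{u}} {γ γ' : C(I, X.carrier)} {a b c d : I} (hcd : c < d)
    (h : γ'.comp (seg c d) = γ) (hp : X.IsPiece γ a b) :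
    X.IsPiece γ' (seg c d a) (seg c d b) := by
  obtain ⟨hab, e, he, φ, hφ, heq⟩ := hp
  refine ⟨?_, e, he, φ, hφ, ?_⟩
  · have hab' : (a : ℝ) < b := hab
    have hcd' : (c : ℝ) < d := hcd
    change (Set.Icc.convexComb c d a : ℝ) < Set.Icc.convexComb c d b
    simp only [Set.Icc.coe_convexComb]
    nlinarith [mul_pos (sub_pos.2 hab') (sub_pos.2 hcd')]
  · rw [seg_comp_affine, ← ContinuousMap.comp_assoc, h, heq]

theorem IsPiece.reparam {X : MdTop.{u}} {γ : C(I, X.carrier)} {a b a' b' : I} {ψ : C(I, I)}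
    (hψ : Monotone ψ) (ha : ψ a' = a) (hb : ψ b' = b) (hp : X.IsPiece γ a b) :
    X.IsPiece (γ.comp ψ) a' b' := by
  obtain ⟨hab, e, he, φ, hφ, heq⟩ := hp
  have hab' : a' < b' := by
    by_contra! hcon
    exact absurd (hψ hcon) (by rw [ha, hb]; exact not_le.2 hab)
  refine ⟨hab', e, he, φ.comp ((segInv a b).comp (ψ.comp (seg a' b'))),
    hφ.comp ((segInv_mono hab).comp (hψ.comp (seg_mono hab'.le))), ?_⟩
  ext t
  have h0 : a ≤ ψ (seg a' b' t) := by
    rw [← ha]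
    refine hψ ?_
    simpa using seg_mono hab'.le (show (0 : I) ≤ t from t.2.1)
  have h1 : ψ (seg a' b' t) ≤ b := by
    rw [← hb]
    refine hψ ?_
    simpa using seg_mono hab'.le (show t ≤ (1 : I) from t.2.2)
  have := congrArg (fun c => c (segInv a b (ψ (seg a' b' t)))) heq
  simp only [ContinuousMap.comp_apply] at this
  rw [seg_segInv hab h0 h1] at this
  exact this

theorem transGen_reparam {X : MdTop.{u}} {γ : C(I, X.carrier)} {ψ : C(I, I)}
    (hψ : IsSurjReparam ψ) {a b : I} (h : Relation.TransGen (X.IsPiece γ) a b) :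
    ∀ a' b', ψ a' = a → ψ b' = b → Relation.TransGen (X.IsPiece (γ.comp ψ)) a' b' := by
  induction h with
  | single h => exact fun a' b' ha hb => .single (h.reparam hψ.1 ha hb)
  | tail _ h ih =>
    intro a' b' ha hb
    obtain ⟨c', hc⟩ := hψ.2 _
    exact (ih a' c' ha hc).tail (h.reparam hψ.1 hc hb)

theorem transGen_normComp {X : MdTop.{u}} {γ₁ γ₂ : C(I, X.carrier)} (h : γ₁ 1 = γ₂ 0)
    (h₁ : Relation.TransGen (X.IsPiece γ₁) 0 1) (h₂ : Relation.TransGen (X.IsPiece γ₂) 0 1) :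
    Relation.TransGen (X.IsPiece (normComp γ₁ γ₂ h)) 0 1 := by
  have k₁ := h₁.lift (p := X.IsPiece (normComp γ₁ γ₂ h)) lowerHalf fun a b hp =>
    hp.affine (by rw [← Subtype.coe_lt_coe]; norm_num) (normComp_lowerHalf γ₁ γ₂ h)
  have k₂ := h₂.lift (p := X.IsPiece (normComp γ₁ γ₂ h)) upperHalf fun a b hp =>
    hp.affine (by rw [← Subtype.coe_lt_coe]; norm_num) (normComp_upperHalf γ₁ γ₂ h)
  change Relation.TransGen _ (lowerHalf 0) (lowerHalf 1) at k₁
  change Relation.TransGen _ (upperHalf 0) (upperHalf 1) at k₂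
  simp only [lowerHalf, upperHalf, seg_zero, seg_one] at k₁ k₂
  exact k₁.trans k₂

theorem isDirected_of_mem {X : MdTop.{u}} {γ : C(I, X.carrier)} (h : γ ∈ X.paths) :
    X.IsDirected γ :=
  Or.inr (.single ⟨zero_lt_one, γ, h, ContinuousMap.id I, monotone_id, by
    rw [seg_zero_one]⟩)

theorem IsDirected.transGen {X : MdTop.{u}} {γ : C(I, X.carrier)} (h : X.IsDirected γ)
    (hne : γ 0 ≠ γ 1) : Relation.TransGen (X.IsPiece γ) 0 1 := by
  rcases h with ⟨x, rfl⟩ | h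
  · exact absurd rfl hne
  · exact h

/-- The set of short directed paths of `X` starting from `α`. -/
def shortPaths (X : MdTop.{u}) (α : X.carrier) : Set C(I, X.carrier) :=
  {γ | X.IsDirected γ ∧ γ 0 = α ∧ ∀ t : I, 0 < t → t < 1 → γ t ∉ X.states}

/-- The space `𝓟⁻_α(X)` of short directed paths starting from `α`: the `Δ`-kelleyfication of the
topology induced by the compact-open topology. -/
abbrev ShortPath (X : MdTop.{u}) (α : X.carrier) : Type u :=
  KDelta (X.shortPaths α)

/-- A short directed path as an element of `𝓟⁻_α(X)`. -/
def ShortPath.mk {X : MdTop.{u}} {α : X.carrier} (γ : C(I, X.carrier))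
    (h : γ ∈ X.shortPaths α) : X.ShortPath α :=
  WithGeneratedByTopology.equiv.symm ⟨γ, h⟩

/-- The continuous map underlying an element of `𝓟⁻_α(X)`. -/
def ShortPath.toMap {X : MdTop.{u}} {α : X.carrier} (γ : X.ShortPath α) : C(I, X.carrier) :=
  (WithGeneratedByTopology.equiv γ).1

/-- The relation generating `≃⁻`: both paths are reparametrizations by elements of `𝓘⁻` of a
third one. -/
def GermRel (X : MdTop.{u}) (α : X.carrier) (γ₁ γ₂ : X.ShortPath α) : Prop :=
  ∃ (γ : X.ShortPath α) (φ₁ φ₂ : C(I, I)), IsStartReparam φ₁ ∧ IsStartReparam φ₂ ∧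
    γ.toMap.comp φ₁ = γ₁.toMap ∧ γ.toMap.comp φ₂ = γ₂.toMap

/-- The branching space `𝓖⁻_α(X)`: the quotient of `𝓟⁻_α(X)` by the equivalence relation generated
by `GermRel`, with the final (quotient) topology. -/
abbrev Branching (X : MdTop.{u}) (α : X.carrier) : Type u :=
  Quot (X.GermRel α)

/-- The class of a short directed path in the branching space. -/
def germ (X : MdTop.{u}) (α : X.carrier) (γ : C(I, X.carrier)) (h : γ ∈ X.shortPaths α) :
    X.Branching α :=
  Quot.mk _ (ShortPath.mk γ h)

end MdTop

/-! ## Globes -/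

section Globe

variable (Z : Type u) [TopologicalSpace Z]

/-- The identifications `(z,0) = 0` and `(z,1) = 1` in `{0,1} ⊔ (Z × [0,1])`; the product is taken
in `Δ`-generated spaces. -/
inductive GlobeRel : ULift.{u} Bool ⊕ KDelta (Z × I) → ULift.{u} Bool ⊕ KDelta (Z × I) → Prop
  | zero (z : Z) :
    GlobeRel (Sum.inr (WithGeneratedByTopology.equiv.symm (z, 0))) (Sum.inl ⟨false⟩)
  | one (z : Z) :
    GlobeRel (Sum.inr (WithGeneratedByTopology.equiv.symm (z, 1))) (Sum.inl ⟨true⟩)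

/-- The underlying space of the topological globe of `Z`. -/
abbrev Globe : Type u := Quot (GlobeRel Z)

variable {Z}

/-- The state `0` of the globe. -/
def Globe.zero : Globe Z := Quot.mk _ (Sum.inl ⟨false⟩)

/-- The state `1` of the globe. -/
def Globe.one : Globe Z := Quot.mk _ (Sum.inl ⟨true⟩)

/-- The point `(z,t)` of the globe. -/
def Globe.pt (z : Z) (t : I) : Globe Z :=
  Quot.mk _ (Sum.inr (WithGeneratedByTopology.equiv.symm (z, t)))

theorem Globe.pt_zero (z : Z) : Globe.pt z 0 = Globe.zero := Quot.sound (GlobeRel.zero z)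

theorem Globe.pt_one (z : Z) : Globe.pt z 1 = Globe.one := Quot.sound (GlobeRel.one z)

/-- The height of a point of the globe: the second projection. -/
def Globe.height : Globe Z → I :=
  Quot.lift (Sum.elim (fun b => if b.down then 1 else 0)
    (fun p => (WithGeneratedByTopology.equiv p).2))
    (by rintro _ _ (z | z) <;> simp)

@[simp] theorem Globe.height_zero : (Globe.zero : Globe Z).height = 0 := rfl

@[simp] theorem Globe.height_one : (Globe.one : Globe Z).height = 1 := rfl

@[simp] theorem Globe.height_pt (z : Z) (t : I) : (Globe.pt z t).height = t := rfl

/-- The path `δ_z : t ↦ (z,t)`. -/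
def Globe.delta (z : Z) : C(I, Globe Z) where
  toFun t := Globe.pt z t
  continuous_toFun := by
    refine continuous_quot_mk.comp (continuous_inr.comp ?_)
    exact (IsGeneratedBy.equiv_symm_comp_continuous_iff (X := fun n : ℕ => Fin n → ℝ)
      (fun t : I => (z, t))).2 (by fun_prop)

/-- The map of globes induced by a continuous map. -/
def Globe.map {Z' : Type u} [TopologicalSpace Z'] (f : C(Z, Z')) : C(Globe Z, Globe Z') where
  toFun := Quot.map (Sum.map id fun p => WithGeneratedByTopology.equiv.symm
    (f (WithGeneratedByTopology.equiv p).1, (WithGeneratedByTopology.equiv p).2))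
    (by
      rintro _ _ (z | z)
      · exact GlobeRel.zero (f z)
      · exact GlobeRel.one (f z))
  continuous_toFun := by
    refine continuous_quot_lift _ (continuous_quot_mk.comp (Continuous.sumMap continuous_id ?_))
    refine (IsGeneratedBy.equiv_symm_comp_continuous_iff (X := fun n : ℕ => Fin n → ℝ)
      (fun p : KDelta (Z × I) => (f (WithGeneratedByTopology.equiv p).1,
        (WithGeneratedByTopology.equiv p).2))).2 ?_
    have h := WithGeneratedByTopology.continuous_equiv (X := fun n : ℕ => Fin n → ℝ)
      (Y := Z × I)
    exact (f.continuous.comp (continuous_fst.comp h)).prodMk (continuous_snd.comp h)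

@[simp] theorem Globe.map_pt {Z' : Type u} [TopologicalSpace Z'] (f : C(Z, Z')) (z : Z) (t : I) :
    Globe.map f (Globe.pt z t) = Globe.pt (f z) t := rfl

end Globe

/-- The topological globe `Glob^top(Z)`: its execution paths are the `δ_z φ` with `φ ∈ 𝓜`. -/
def glob (Z : Type u) [TopologicalSpace Z] : MdTop.{u} where
  carrier := Globe Z
  states := {Globe.zero, Globe.one}
  paths := {γ | ∃ (z : Z) (φ : C(I, I)), IsSurjReparam φ ∧ γ = (Globe.delta z).comp φ}
  source_mem := by
    rintro _ ⟨z, φ, hφ, rfl⟩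
    exact Or.inl ((congrArg (Globe.pt z) hφ.map_zero).trans (Globe.pt_zero z))
  target_mem := by
    rintro _ ⟨z, φ, hφ, rfl⟩
    exact Or.inr ((congrArg (Globe.pt z) hφ.map_one).trans (Globe.pt_one z))
  comp_mem := by
    rintro _ ⟨z, φ, hφ, rfl⟩ ψ hψ
    exact ⟨z, φ.comp ψ, ⟨hφ.1.comp hψ.1, hφ.2.comp hψ.2⟩, rfl⟩
  normComp_mem := by
    rintro _ ⟨z, φ, hφ, rfl⟩ _ ⟨w, ψ, hψ, rfl⟩ h
    have h' : φ 1 = ψ 0 := congrArg Globe.height h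
    rw [hφ.map_one, hψ.map_zero] at h'
    exact absurd h' one_ne_zero

/-- The map of topological globes induced by a continuous map. -/
def globMap {Z Z' : Type u} [TopologicalSpace Z] [TopologicalSpace Z'] (f : C(Z, Z')) :
    glob Z ⟶ glob Z' where
  toMap := Globe.map f
  map_states := by
    rintro _ (rfl | rfl)
    · exact Or.inl rfl
    · exact Or.inr rfl
  map_paths := by
    rintro _ ⟨z, φ, hφ, rfl⟩
    exact ⟨f z, φ, hφ, rfl⟩

theorem glob_height_lt {Z : Type u} [TopologicalSpace Z] {γ : C(I, Globe Z)} {a b : I}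
    (h : Relation.TransGen ((glob Z).IsPiece γ) a b) :
    γ a = γ b ∨ (γ a).height < (γ b).height := by
  have step : ∀ c d, (glob Z).IsPiece γ c d → γ c = γ d ∨ (γ c).height < (γ d).height := by
    rintro c d ⟨-, _, ⟨z, ψ, hψ, rfl⟩, φ, hφ, heq⟩
    have h0 : γ c = Globe.pt z (ψ (φ 0)) := by
      have h : γ (seg c d 0) = Globe.pt z (ψ (φ 0)) := congrArg (fun k => k 0) heq
      rwa [seg_zero] at h
    have h1 : γ d = Globe.pt z (ψ (φ 1)) := by
      have h : γ (seg c d 1) = Globe.pt z (ψ (φ 1)) := congrArg (fun k => k 1) heq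
      rwa [seg_one] at h
    rw [h0, h1]
    rcases (hψ.1 (hφ (zero_le_one : (0 : I) ≤ 1))).eq_or_lt with h | h
    · exact Or.inl (by rw [h])
    · exact Or.inr h
  induction h with
  | single h => exact step _ _ h
  | tail _ h ih =>
    rcases ih with e | l <;> rcases step _ _ h with e' | l'
    · exact Or.inl (e.trans e')
    · exact Or.inr (e ▸ l')
    · exact Or.inr (e' ▸ l)
    · exact Or.inr (l.trans l')

/-- The subdivided globe `Glob^top(Z)_F`: the underlying space is that of `Glob^top(Z)`, the states
are `0`, `1` and the elements of `F`, the execution paths are the directed paths of `Glob^top(Z)`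
from a state to a different state. -/
def globSub (Z : Type u) [TopologicalSpace Z] (F : Set (Globe Z)) : MdTop.{u} where
  carrier := Globe Z
  states := {Globe.zero, Globe.one} ∪ F
  paths := {γ : C(I, Globe Z) | γ 0 ∈ {Globe.zero, Globe.one} ∪ F ∧ γ 1 ∈ {Globe.zero, Globe.one} ∪ F ∧
    γ 0 ≠ γ 1 ∧ (glob Z).IsDirected γ}
  source_mem := fun _ h => h.1
  target_mem := fun _ h => h.2.1
  comp_mem := by
    rintro γ ⟨h0, h1, hne, hd⟩ φ hφ
    have e0 : (γ.comp φ) 0 = γ 0 := congrArg γ hφ.map_zero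
    have e1 : (γ.comp φ) 1 = γ 1 := congrArg γ hφ.map_one
    refine ⟨e0 ▸ h0, e1 ▸ h1, by rwa [e0, e1], Or.inr ?_⟩
    exact MdTop.transGen_reparam hφ (MdTop.IsDirected.transGen hd hne) 0 1 hφ.map_zero hφ.map_one
  normComp_mem := by
    rintro γ₁ ⟨h0, -, hne, hd⟩ γ₂ ⟨-, h1, hne', hd'⟩ h
    have e0 : (normComp γ₁ γ₂ h) 0 = γ₁ 0 := Path.source _
    have e1 : (normComp γ₁ γ₂ h) 1 = γ₂ 1 := Path.target _
    have t := MdTop.IsDirected.transGen hd hne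
    have t' := MdTop.IsDirected.transGen hd' hne'
    refine ⟨e0 ▸ h0, e1 ▸ h1, ?_, Or.inr (MdTop.transGen_normComp (X := glob Z) h t t')⟩
    rw [e0, e1]
    intro hcon
    have l := (glob_height_lt t).resolve_left hne
    have l' := (glob_height_lt t').resolve_left hne'
    rw [h, hcon] at l
    exact lt_asymm l l'

/-- The subdivision map `Glob^top(Z) → Glob^top(Z)_F`, the identity on underlying spaces. -/
def globSbd (Z : Type u) [TopologicalSpace Z] (F : Set (Globe Z)) : glob Z ⟶ globSub Z F where
  toMap := ContinuousMap.id _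
  map_states := fun _ h => Or.inl h
  map_paths := by
    intro γ hγ
    refine ⟨Or.inl ((glob Z).source_mem γ hγ), Or.inl ((glob Z).target_mem γ hγ), ?_,
      MdTop.isDirected_of_mem hγ⟩
    obtain ⟨z, φ, hφ, rfl⟩ := hγ
    intro hcon
    have h' : φ 0 = φ 1 := congrArg Globe.height hcon
    rw [hφ.map_zero, hφ.map_one] at h'
    exact zero_ne_one h'

/-! ## Cellular multipointed d-spaces -/

/-- The inclusion of the sphere `S^(n-1)` into the disk `D^n`; the sphere is empty for `n = 0`. -/
noncomputable def sphereIncl (n : ℕ) : C(TopCat.diskBoundary.{u} n, TopCat.disk.{u} n) :=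
  (TopCat.diskBoundaryInclusion n).hom

/-- The maps `Glob^top(S^(n-1)) → Glob^top(D^n)`, `n ≥ 0`. -/
inductive globIncl : MorphismProperty MdTop.{u}
  | mk (n : ℕ) : globIncl (globMap (sphereIncl n))

/-- A cellular multipointed `d`-space: the colimit of a colimit-preserving well-ordered tower that
starts with a set and whose successive maps are pushouts of maps
`Glob^top(S^(n-1)) → Glob^top(D^n)`, `n ≥ 0`. -/
def IsCellular (X : MdTop.{u}) : Prop :=
  ∃ (S : Type u) (i : MdTop.ofSet S ⟶ X),
    MorphismProperty.transfiniteCompositions.{u} globIncl.pushouts i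

end DirTop

/-!
A pushout of `Glob^top(Dⁿ) → Glob^top(Dⁿ)_F` along `g : Glob^top(Dⁿ) → A` changes neither the
underlying space nor the directed paths: it only turns the finitely many points of `T = g(F)` into
states. On underlying spaces, the inverse of `f : A → X` comes from the universal property, applied
to the space `A` with the additional states `T` and with all composites of pieces of execution paths
between states as execution paths (`exists_inverse_of_isPushout`). Hence composition with `f`
identifies the short directed paths of `X` from `f α` with those short directed paths of `A` from
`α` which avoid `T` (`isShortPathRestriction_of_inverse`).

The class of a short path in the branching space only depends on an arbitrarily small initial
segment (`germ_comp_eq_germ_comp_seg`). A short path `γ` of `A` never returns to `α` before its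
end, and `T \ {α}`, being finite, is closed in `A`, since `A` is a `T₁` space. So `γ` avoids `T`
on some `]0,ε[`, and the class in `X` of its restriction to `[0,ε]` is well defined
(`initialGerm`). The condition that `γ` avoids `T \ {α}` on `[0,ε]` is open for the compact-open
topology, so that a single `ε` serves in a neighbourhood of `γ`. An open subset of a `Δ`-generated
space being `Δ`-generated, this gives the continuity of the class
(`continuous_initialGerm`). The inverse homeomorphism is induced by the inverse of `f`.

Cellularity is used only for the `T₁` property (`IsCellular.t1Space`). The underlying space functor
is a left adjoint, so a cellular multipointed `d`-space is a transfinite composite of spaces along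
pushouts of the maps `Glob^top(Sⁿ⁻¹) → Glob^top(Dⁿ)`, and these are closed and injective. The only
subtlety is that cylinders are formed in `Δ`-generated spaces: the map is closed because the
product `Sⁿ⁻¹ × [0,1]` is already `Δ`-generated.
-/

namespace DirTop

/-! ### Open subsets of `Δ`-generated spaces -/

/-- An open subset `U` of `ℝⁿ` is `Δ`-generated: near each of its points it is a retract, by
clamping the coordinates, of the whole of `ℝⁿ`. -/
instance deltaGenerated_opens (n : ℕ) (U : TopologicalSpace.Opens (Fin n → ℝ)) :
    DeltaGeneratedSpace U := by
  refine ⟨continuous_def.2 fun V hV => ?_⟩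
  rw [WithGeneratedByTopology.isOpen_iff] at hV
  rw [isOpen_iff_mem_nhds]
  intro x hx
  obtain ⟨δ, hδ, hball⟩ := Metric.nhds_basis_closedBall.mem_iff.1 (U.2.mem_nhds x.2)
  let p : (Fin n → ℝ) → (Fin n → ℝ) := fun v i => max (x.1 i - δ) (min (v i) (x.1 i + δ))
  have hp : Continuous p := by fun_prop
  have hpU : ∀ v, p v ∈ U := fun v => hball <| (dist_pi_le_iff hδ.le).2 fun i => by
    rw [Real.dist_eq, abs_le]
    constructor
    · linarith [le_max_left (x.1 i - δ) (min (v i) (x.1 i + δ))]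
    · have := max_le (by linarith : x.1 i - δ ≤ x.1 i + δ) (min_le_right (v i) (x.1 i + δ))
      linarith
  have hfix : ∀ v ∈ Metric.closedBall x.1 δ, p v = v := fun v hv => funext fun i => by
    have h := (dist_pi_le_iff hδ.le).1 (Metric.mem_closedBall.1 hv) i
    rw [Real.dist_eq, abs_le] at h
    change max _ (min _ _) = _
    rw [min_eq_left (by linarith), max_eq_right (by linarith)]
  let q : C(Fin n → ℝ, U) := ⟨fun v => ⟨p v, hpU v⟩, by fun_prop⟩
  have hq : ∀ y : U, y.1 ∈ Metric.closedBall x.1 δ → q y.1 = y :=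
    fun y hy => Subtype.ext (hfix _ hy)
  have h1 : ∀ᶠ y : U in 𝓝 x, y.1 ∈ Metric.closedBall x.1 δ :=
    continuous_subtype_val.continuousAt.eventually (Metric.closedBall_mem_nhds _ hδ)
  have hx' : x.1 ∈ q ⁻¹' (WithGeneratedByTopology.equiv.symm ⁻¹' V) := by
    change WithGeneratedByTopology.equiv.symm (q x.1) ∈ V
    rw [hq x (Metric.mem_closedBall_self hδ.le)]
    exact hx
  have h2 := continuous_subtype_val.continuousAt.eventually ((hV q).mem_nhds hx')
  filter_upwards [h1, h2] with y hy1 hy2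
  have := hq y hy1
  change WithGeneratedByTopology.equiv.symm (q y.1) ∈ V at hy2
  rwa [this] at hy2

/-- Finite-dimensional normed spaces are `Δ`-generated. -/
theorem deltaGenerated_of_finiteDimensional (E : Type*) [NormedAddCommGroup E] [NormedSpace ℝ E]
    [FiniteDimensional ℝ E] : DeltaGeneratedSpace E :=
  let e : (Fin (Module.finrank ℝ E) → ℝ) ≃L[ℝ] E :=
    ContinuousLinearEquiv.ofFinrankEq (by simp)
  e.toHomeomorph.isQuotientMap.isGeneratedBy (X := fun n : ℕ => Fin n → ℝ)

/-- The cylinder on the sphere is `Δ`-generated, being a retract of the open subset `x ≠ 0` of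
the space of pairs `(x, t)`. -/
instance deltaGenerated_sphere_prod (n : ℕ) :
    DeltaGeneratedSpace (TopCat.diskBoundary.{u} n × I) := by
  have : DeltaGeneratedSpace (EuclideanSpace ℝ (Fin n) × ℝ) :=
    deltaGenerated_of_finiteDimensional _
  let U : Set (EuclideanSpace ℝ (Fin n) × ℝ) := {v | v.1 ≠ 0}
  have hU : IsOpen U := isOpen_ne.preimage continuous_fst
  have : DeltaGeneratedSpace U := hU.isGeneratedBy
  have hmem : ∀ v : U, (‖v.1.1‖⁻¹ • v.1.1) ∈ Metric.sphere (0 : EuclideanSpace ℝ (Fin n)) 1 := by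
    intro v
    rw [mem_sphere_zero_iff_norm, norm_smul, norm_inv, norm_norm,
      inv_mul_cancel₀ (norm_ne_zero_iff.2 v.2)]
  let ρ : U → TopCat.diskBoundary.{u} n × I :=
    fun v => (⟨⟨‖v.1.1‖⁻¹ • v.1.1, hmem v⟩⟩, Set.projIcc 0 1 zero_le_one v.1.2)
  have hρ : Continuous ρ := by
    refine Continuous.prodMk (continuous_uliftUp.comp (Continuous.subtype_mk ?_ _))
      (continuous_projIcc.comp (by fun_prop))
    exact Continuous.smul (Continuous.inv₀ (by fun_prop) fun v => norm_ne_zero_iff.2 v.2)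
      (by fun_prop)
  have hne : ∀ z : TopCat.diskBoundary.{u} n, z.down.1 ≠ 0 := fun z h => by
    have := mem_sphere_zero_iff_norm.1 z.down.2
    rw [h, norm_zero] at this
    exact zero_ne_one this
  let s : TopCat.diskBoundary.{u} n × I → U := fun p => ⟨(p.1.down.1, p.2.1), hne p.1⟩
  have hs : Continuous s := by
    refine Continuous.subtype_mk (Continuous.prodMk ?_ (by fun_prop)) _
    exact continuous_subtype_val.comp (continuous_uliftDown.comp continuous_fst)
  refine (IsQuotientMap.of_inverse hs hρ fun p => ?_).isGeneratedBy (X := fun n : ℕ => Fin n → ℝ)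
  refine Prod.ext (ULift.ext _ _ (Subtype.ext ?_)) (Set.projIcc_val zero_le_one p.2)
  change ‖p.1.down.1‖⁻¹ • p.1.down.1 = p.1.down.1
  rw [mem_sphere_zero_iff_norm.1 p.1.down.2, inv_one, one_smul]

/-! ### The topology of globes -/

section Globe

variable {Z Z' : Type u} [TopologicalSpace Z] [TopologicalSpace Z']

theorem Globe.eq_zero_or_eq_one_or_eq_pt (x : Globe Z) :
    x = Globe.zero ∨ x = Globe.one ∨ ∃ z t, t ≠ 0 ∧ t ≠ 1 ∧ x = Globe.pt z t := by
  obtain ⟨⟨_ | _⟩ | p, rfl⟩ := Quot.exists_rep x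
  · exact Or.inl rfl
  · exact Or.inr (Or.inl rfl)
  · obtain ⟨⟨z, t⟩, rfl⟩ := WithGeneratedByTopology.equiv.symm.surjective p
    change Globe.pt z t = _ ∨ Globe.pt z t = _ ∨ _
    by_cases h0 : t = 0
    · exact Or.inl (h0 ▸ Globe.pt_zero z)
    by_cases h1 : t = 1
    · exact Or.inr (Or.inl (h1 ▸ Globe.pt_one z))
    · exact Or.inr (Or.inr ⟨z, t, h0, h1, rfl⟩)

open Classical in
/-- The first coordinate of a point of the globe which is not one of the two states. -/
noncomputable def Globe.base : Globe Z → Option Z :=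
  Quot.lift (Sum.elim (fun _ => none) (fun p =>
    if (WithGeneratedByTopology.equiv p).2 = 0 ∨ (WithGeneratedByTopology.equiv p).2 = 1 then none
    else some (WithGeneratedByTopology.equiv p).1)) (by rintro _ _ (z | z) <;> simp)

theorem Globe.pt_eq_pt {z z' : Z} {t t' : I} (h0 : t ≠ 0) (h1 : t ≠ 1) :
    Globe.pt z t = Globe.pt z' t' ↔ z = z' ∧ t = t' := by
  refine ⟨fun h => ?_, by rintro ⟨rfl, rfl⟩; rfl⟩
  obtain rfl : t = t' := congrArg Globe.height h
  have := congrArg Globe.base h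
  simpa [Globe.base, Globe.pt, h0, h1] using this

theorem Globe.pt_eq_zero {z : Z} {t : I} : Globe.pt z t = Globe.zero ↔ t = 0 :=
  ⟨fun h => congrArg Globe.height h, fun h => h ▸ Globe.pt_zero z⟩

theorem Globe.pt_eq_one {z : Z} {t : I} : Globe.pt z t = Globe.one ↔ t = 1 :=
  ⟨fun h => congrArg Globe.height h, fun h => h ▸ Globe.pt_one z⟩

theorem Globe.isClosed_iff {C : Set (Globe Z)} :
    IsClosed C ↔ IsClosed {p : KDelta (Z × I) | Globe.pt (WithGeneratedByTopology.equiv p).1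
      (WithGeneratedByTopology.equiv p).2 ∈ C} := by
  rw [← isQuotientMap_quot_mk.isClosed_preimage, isClosed_sum_iff]
  exact and_iff_right (isClosed_discrete _)

theorem isClosed_kDelta_of_isClosed {Y : Type*} [TopologicalSpace Y] {C : Set Y}
    (hC : IsClosed C) : IsClosed {p : KDelta Y | WithGeneratedByTopology.equiv p ∈ C} :=
  hC.preimage WithGeneratedByTopology.continuous_equiv

theorem Globe.isClosed_setOf_snd_eq (s : I) :
    IsClosed {p : KDelta (Z × I) | (WithGeneratedByTopology.equiv p).2 = s} :=
  isClosed_kDelta_of_isClosed (isClosed_singleton.preimage continuous_snd)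

instance Globe.t1Space [T1Space Z] : T1Space (Globe Z) := by
  refine ⟨fun x => Globe.isClosed_iff.2 ?_⟩
  obtain rfl | rfl | ⟨z, t, h0, h1, rfl⟩ := Globe.eq_zero_or_eq_one_or_eq_pt x
  · simpa only [Set.mem_singleton_iff, Globe.pt_eq_zero] using Globe.isClosed_setOf_snd_eq 0
  · simpa only [Set.mem_singleton_iff, Globe.pt_eq_one] using Globe.isClosed_setOf_snd_eq 1
  · have := isClosed_kDelta_of_isClosed (isClosed_singleton (x := (z, t)))
    convert this using 3 with p
    rw [Set.mem_singleton_iff, Set.mem_singleton_iff, eq_comm, Globe.pt_eq_pt h0 h1,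
      Prod.ext_iff, eq_comm, @eq_comm _ t]

theorem Globe.height_map (i : C(Z, Z')) (x : Globe Z) : (Globe.map i x).height = x.height := by
  obtain rfl | rfl | ⟨z, t, -, -, rfl⟩ := Globe.eq_zero_or_eq_one_or_eq_pt x <;> rfl

theorem Globe.map_injective {i : C(Z, Z')} (hi : Function.Injective i) :
    Function.Injective (Globe.map i) := by
  intro x y h
  have hh : x.height = y.height := by rw [← Globe.height_map i x, h, Globe.height_map]
  obtain rfl | rfl | ⟨z, t, h0, h1, rfl⟩ := Globe.eq_zero_or_eq_one_or_eq_pt x <;>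
    obtain rfl | rfl | ⟨w, s, k0, k1, rfl⟩ := Globe.eq_zero_or_eq_one_or_eq_pt y <;>
    simp_all [eq_comm]
  rw [Globe.pt_eq_pt k0 k1] at h
  rw [hi h.1]

/-- A closed embedding `Z → Z'` induces a closed map of globes, as soon as the topology of the
cylinder on `Z` does not have to be refined. -/
theorem Globe.isClosedMap_map [DeltaGeneratedSpace (Z × I)] {i : C(Z, Z')}
    (hi : IsClosedEmbedding i) : IsClosedMap (Globe.map i) := by
  intro C hC
  rw [Globe.isClosed_iff] at hC ⊢
  have h1 : IsClosed {p : Z × I | Globe.pt p.1 p.2 ∈ C} :=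
    hC.preimage (IsGeneratedBy.continuous_equiv_symm (X := fun n : ℕ => Fin n → ℝ))
  have h2 := isClosed_kDelta_of_isClosed
    ((hi.prodMap (IsClosedEmbedding.id (X := I))).isClosedMap _ h1)
  have h3 : IsClosed {p : KDelta (Z' × I) |
      (WithGeneratedByTopology.equiv p).2 = 0 ∧ Globe.zero ∈ C} :=
    (Globe.isClosed_setOf_snd_eq 0).inter isClosed_const
  have h4 : IsClosed {p : KDelta (Z' × I) |
      (WithGeneratedByTopology.equiv p).2 = 1 ∧ Globe.one ∈ C} :=
    (Globe.isClosed_setOf_snd_eq 1).inter isClosed_const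
  convert (h2.union h3).union h4 using 1
  ext p
  obtain ⟨⟨z, t⟩, rfl⟩ := WithGeneratedByTopology.equiv.symm.surjective p
  simp only [Set.mem_ofPred_eq, Set.mem_union, Equiv.apply_symm_apply]
  constructor
  · rintro ⟨x, hx, h⟩
    obtain rfl | rfl | ⟨w, s, h0, h1, rfl⟩ := Globe.eq_zero_or_eq_one_or_eq_pt x
    · exact Or.inl (Or.inr ⟨Globe.pt_eq_zero.1 h.symm, hx⟩)
    · exact Or.inr ⟨Globe.pt_eq_one.1 h.symm, hx⟩
    · rw [Globe.map_pt, Globe.pt_eq_pt h0 h1] at h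
      exact Or.inl (Or.inl ⟨(w, s), hx, Prod.ext h.1 h.2⟩)
  · rintro ((⟨⟨w, s⟩, hw, h⟩ | ⟨h, h'⟩) | ⟨h, h'⟩)
    · obtain ⟨rfl, rfl⟩ := Prod.ext_iff.1 h
      exact ⟨_, hw, rfl⟩
    · exact ⟨_, h', (Globe.pt_eq_zero.2 h).symm⟩
    · exact ⟨_, h', (Globe.pt_eq_one.2 h).symm⟩

end Globe

theorem isClosedEmbedding_sphereIncl (n : ℕ) : IsClosedEmbedding (sphereIncl.{u} n) := by
  have : T2Space (TopCat.disk.{u} n) :=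
    inferInstanceAs (T2Space (ULift (Metric.closedBall (0 : EuclideanSpace ℝ (Fin n)) 1)))
  exact (sphereIncl n).continuous.isClosedEmbedding
    ((TopCat.mono_iff_injective (TopCat.diskBoundaryInclusion n)).1 inferInstance)

instance t1Space_disk (n : ℕ) : T1Space (TopCat.disk.{u} n) :=
  inferInstanceAs (T1Space (ULift (Metric.closedBall (0 : EuclideanSpace ℝ (Fin n)) 1)))

/-! ### Underlying spaces of colimits -/

namespace MdTop

/-- The functor which sends a multipointed `d`-space to its underlying space. -/
def toTop : MdTop.{u} ⥤ TopCat.{u} where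
  obj X := TopCat.of X.carrier
  map f := TopCat.ofHom f.toMap

/-- A `Δ`-generated space, in which all points are states and all paths are execution paths. -/
def codiscrete (Y : Type u) [TopologicalSpace Y] [DeltaGeneratedSpace Y] : MdTop.{u} where
  carrier := Y
  states := Set.univ
  paths := Set.univ
  source_mem _ _ := trivial
  target_mem _ _ := trivial
  comp_mem _ _ _ _ := trivial
  normComp_mem _ _ _ _ _ := trivial

/-- A continuous map, as a map to a codiscrete multipointed `d`-space. -/
def toCodiscrete {X : MdTop.{u}} {Y : Type u} [TopologicalSpace Y] [DeltaGeneratedSpace Y]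
    (f : C(X.carrier, Y)) : X ⟶ codiscrete Y where
  toMap := f
  map_states _ _ := trivial
  map_paths _ _ := trivial

/-- The right adjoint of `toTop`. -/
def ofTop : TopCat.{u} ⥤ MdTop.{u} where
  obj Y := codiscrete (KDelta Y)
  map f := toCodiscrete
    ⟨fun y => WithGeneratedByTopology.equiv.symm (f (WithGeneratedByTopology.equiv y)),
      (IsGeneratedBy.equiv_symm_comp_continuous_iff _ _).2
        (f.hom.continuous.comp WithGeneratedByTopology.continuous_equiv)⟩

/-- The underlying space of a multipointed `d`-space is left adjoint to `ofTop`. -/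
def adj : toTop.{u} ⊣ ofTop.{u} :=
  Adjunction.mkOfHomEquiv
    { homEquiv _ _ :=
        { toFun f := toCodiscrete ⟨fun x => WithGeneratedByTopology.equiv.symm (f x),
            (IsGeneratedBy.equiv_symm_comp_continuous_iff _ _).2 f.hom.continuous⟩
          invFun f := TopCat.ofHom ⟨fun x => WithGeneratedByTopology.equiv (f.toMap x),
            WithGeneratedByTopology.continuous_equiv.comp f.toMap.continuous⟩
          left_inv _ := rfl
          right_inv _ := rfl }
      homEquiv_naturality_left_symm _ _ := rfl
      homEquiv_naturality_right _ _ := rfl }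

instance : toTop.{u}.IsLeftAdjoint := adj.isLeftAdjoint

end MdTop

open Limits

/-- In the colimit of a chain of injective maps between `T₁` spaces, the preimage of a point in a
stage of the chain has at most one element. -/
theorem isColimit_injective_and_t1Space {J : Type u} [LinearOrder J] [Nonempty J]
    {G : J ⥤ TopCat.{u}} {c : Cocone G} (hc : IsColimit c) (hT : ∀ j, T1Space (G.obj j))
    (hinj : ∀ (i j : J) (a : i ⟶ j), Function.Injective (G.map a)) :
    (∀ j, Function.Injective (c.ι.app j)) ∧ T1Space c.pt := by
  have hc' := isColimitOfPreserves (forget TopCat.{u}) hc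
  have hι : ∀ j, Function.Injective (c.ι.app j) := fun j x y h => by
    obtain ⟨k, a, hk⟩ := (Types.FilteredColimit.isColimit_eq_iff' hc' x y).1 h
    exact hinj _ _ a hk
  refine ⟨hι, ⟨fun p => (TopCat.isClosed_iff_of_isColimit c hc _).2 fun j => ?_⟩⟩
  exact (Set.Subsingleton.preimage (Set.subsingleton_singleton) (hι j)).isClosed

/-- Gluing a `T₁` space along a closed injective map preserves the `T₁` property. -/
theorem isPushout_injective_and_t1Space {S D Y P : TopCat.{u}} {h : S ⟶ Y} {i : S ⟶ D}
    {j : Y ⟶ P} {k : D ⟶ P} (sq : IsPushout h i j k) (hi : Function.Injective i)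
    (hi' : IsClosedMap i) [T1Space D] [T1Space Y] : Function.Injective j ∧ T1Space P := by
  have sq' := (sq.map (forget TopCat.{u})).flip
  have hj : Function.Injective j :=
    Types.pushoutCocone_inr_injective_of_isColimit sq'.isColimit hi
  have hcl : ∀ C : Set P, IsClosed (j ⁻¹' C) → IsClosed (k ⁻¹' C) → IsClosed C := by
    intro C h1 h2
    refine (TopCat.isClosed_iff_of_isColimit sq.cocone sq.isColimit C).2 ?_
    rintro (_ | _ | _)
    · exact h1.preimage h.hom.continuous
    · exact h1
    · exact h2
  have hjk : ∀ y d, k d = j y → ∃ s, i s = d ∧ h s = y := fun y d e =>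
    (Types.pushoutCocone_inl_eq_inr_iff_of_isColimit sq'.isColimit hi d y).1 e
  refine ⟨hj, ⟨fun p => ?_⟩⟩
  by_cases hp : p ∈ Set.range j
  · obtain ⟨y, rfl⟩ := hp
    refine hcl _ (Set.Subsingleton.preimage (Set.subsingleton_singleton) hj).isClosed ?_
    convert hi' _ (isClosed_singleton.preimage h.hom.continuous : IsClosed (h ⁻¹' {y})) using 1
    ext d
    constructor
    · intro e
      obtain ⟨s, rfl, hs⟩ := hjk y d e
      exact ⟨s, hs, rfl⟩
    · rintro ⟨s, rfl, rfl⟩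
      exact (ConcreteCategory.congr_hom sq.w s).symm
  · refine hcl _ ?_ ?_
    · convert isClosed_empty
      exact Set.eq_empty_of_forall_notMem fun y hy => hp ⟨y, hy⟩
    · -- The map to `Option D` which is `none` on `Y` and `some` on the complement of the image
      -- of `S` in `D` shows that `k` is injective on this complement.
      classical
      let v : D → Option D := fun d => if d ∈ Set.range i then none else some d
      obtain ⟨w, hwk, hwj⟩ := sq'.exists_desc (W := Option D) (↾v) (↾fun _ => none) 
        (ConcreteCategory.hom_ext _ _ fun s => if_pos (Set.mem_range_self (f := i) s))
      have hk : ∀ d, k d = p → w p = some d := fun d hd => by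
        have hd' : d ∉ Set.range i := by
          intro ⟨s, hs⟩
          subst hs
          exact hp ⟨h s, (ConcreteCategory.congr_hom sq.w s).trans hd⟩
        rw [← hd]
        exact (ConcreteCategory.congr_hom hwk d).trans (if_neg hd')
      exact Set.Subsingleton.isClosed fun d hd d' hd' =>
        Option.some_injective _ ((hk d hd).symm.trans (hk d' hd'))


/-- Pushouts of the maps `Glob^top(S^(n-1)) → Glob^top(D^n)` preserve the `T₁` property. -/
theorem injective_and_t1Space_of_pushouts {X Y : MdTop.{u}} {f : X ⟶ Y} (hf : globIncl.pushouts f)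
    (hX : T1Space X.carrier) : Function.Injective f.toMap ∧ T1Space Y.carrier := by
  obtain ⟨_, _, _, h, k, ⟨n⟩, sq⟩ := hf
  have : T1Space (MdTop.toTop.obj _) := hX
  have : T1Space (MdTop.toTop.obj (glob (TopCat.disk.{u} n))) :=
    inferInstanceAs (T1Space (Globe (TopCat.disk.{u} n)))
  exact isPushout_injective_and_t1Space (sq.map MdTop.toTop)
    (Globe.map_injective (isClosedEmbedding_sphereIncl n).injective)
    (Globe.isClosedMap_map (isClosedEmbedding_sphereIncl n))

/-- In a tower of pushouts of globe inclusions starting with a `T₁` space, all spaces are `T₁` and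
all transition maps are injective. -/
theorem tower_t1Space_and_injective {J : Type u} [LinearOrder J] [SuccOrder J] [OrderBot J]
    [WellFoundedLT J] {X Y : MdTop.{u}} {f : X ⟶ Y}
    (hf : globIncl.{u}.pushouts.TransfiniteCompositionOfShape J f) (hX : T1Space X.carrier)
    (j : J) : T1Space (hf.F.obj j).carrier ∧
      ∀ (i : J) (a : i ⟶ j), Function.Injective (hf.F.map a).toMap := by
  induction j using SuccOrder.limitRecOn with
  | isMin j hj =>
    obtain rfl := hj.eq_bot
    refine ⟨?_, fun i a => ?_⟩
    · have : T1Space (MdTop.toTop.obj X) := hX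
      exact (TopCat.homeoOfIso (MdTop.toTop.mapIso hf.isoBot)).symm.t1Space
    · obtain rfl : i = ⊥ := le_bot_iff.1 (leOfHom a)
      obtain rfl : a = 𝟙 _ := Subsingleton.elim _ _
      rw [CategoryTheory.Functor.map_id]
      exact Function.injective_id
  | succ j hj ih =>
    obtain ⟨hT, hinj⟩ := ih
    obtain ⟨h1, h2⟩ := injective_and_t1Space_of_pushouts (hf.map_mem j hj) hT
    refine ⟨h2, fun i a => ?_⟩
    obtain hi | hi := (leOfHom a).lt_or_eq
    · obtain rfl : a = homOfLE ((Order.lt_succ_iff_of_not_isMax hj).1 hi) ≫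
        homOfLE (Order.le_succ j) := Subsingleton.elim _ _
      rw [hf.F.map_comp]
      exact h1.comp (hinj _ _)
    · subst hi
      obtain rfl : a = 𝟙 _ := Subsingleton.elim _ _
      rw [CategoryTheory.Functor.map_id]
      exact Function.injective_id
  | isSuccLimit j hj ih =>
    have : Nonempty (Set.Iio j) := ⟨⟨⊥, hj.bot_lt⟩⟩
    obtain ⟨h1, h2⟩ := isColimit_injective_and_t1Space
      (isColimitOfPreserves MdTop.toTop (hf.F.isColimitOfIsWellOrderContinuous j hj))
      (fun k => (ih k.1 k.2).1) (fun i k a => (ih k.1 k.2).2 i.1 (homOfLE (leOfHom a)))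
    refine ⟨h2, fun i a => ?_⟩
    obtain hi | hi := (leOfHom a).lt_or_eq
    · exact h1 ⟨i, hi⟩
    · subst hi
      obtain rfl : a = 𝟙 _ := Subsingleton.elim _ _
      rw [CategoryTheory.Functor.map_id]
      exact Function.injective_id

theorem IsCellular.t1Space {A : MdTop.{u}} (hA : IsCellular A) : T1Space A.carrier := by
  obtain ⟨S, i, hi⟩ := hA
  obtain ⟨J, _, _, _, _, ⟨hi⟩⟩ := (MorphismProperty.transfiniteCompositions_iff _ _).1 hi
  have hS : T1Space (MdTop.ofSet S).carrier := by
    have : @DiscreteTopology (MdTop.ofSet S).carrier (MdTop.ofSet S).top := ⟨rfl⟩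
    infer_instance
  exact (isColimit_injective_and_t1Space (isColimitOfPreserves MdTop.toTop hi.isColimit)
    (fun j => (tower_t1Space_and_injective hi hS j).1)
    (fun i j a => (tower_t1Space_and_injective hi hS j).2 i a)).2

/-! ### Directed paths, reparametrizations and subdivisions -/

namespace MdTop

theorem IsPiece.comp_of_le {X : MdTop.{u}} {γ : C(I, X.carrier)} {a b a' b' : I} {ψ : C(I, I)}
    (hψ : Monotone ψ) (hab' : a' < b') (ha : a ≤ ψ a') (hb : ψ b' ≤ b) (hp : X.IsPiece γ a b) :
    X.IsPiece (γ.comp ψ) a' b' := by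
  obtain ⟨hab, e, he, φ, hφ, heq⟩ := hp
  refine ⟨hab', e, he, φ.comp ((segInv a b).comp (ψ.comp (seg a' b'))),
    hφ.comp ((segInv_mono hab).comp (hψ.comp (seg_mono hab'.le))), ?_⟩
  ext t
  have h0 : a ≤ ψ (seg a' b' t) :=
    ha.trans (hψ (by simpa using seg_mono hab'.le (show (0 : I) ≤ t from t.2.1)))
  have h1 : ψ (seg a' b' t) ≤ b :=
    (hψ (by simpa using seg_mono hab'.le (show t ≤ (1 : I) from t.2.2))).trans hb
  have := congrArg (fun c => c (segInv a b (ψ (seg a' b' t)))) heq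
  simp only [ContinuousMap.comp_apply] at this
  rwa [seg_segInv hab h0 h1] at this

/-- The reparametrization of a composition of pieces by a nondecreasing map, not necessarily
surjective, is a composition of pieces. -/
theorem transGen_comp {X : MdTop.{u}} {γ : C(I, X.carrier)} {ψ : C(I, I)} (hψ : Monotone ψ)
    {a b : I} (h : Relation.TransGen (X.IsPiece γ) a b) :
    ∀ a' b', a' < b' → a ≤ ψ a' → ψ b' ≤ b →
      Relation.TransGen (X.IsPiece (γ.comp ψ)) a' b' := by
  induction h with
  | single h => exact fun a' b' hab ha hb => .single (h.comp_of_le hψ hab ha hb)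
  | @tail c d _ h ih =>
    intro a' b' hab ha hb
    obtain hc | hc := le_or_gt (ψ b') c
    · exact ih a' b' hab ha hc
    obtain hc' | hc' := le_or_gt c (ψ a')
    · exact .single (h.comp_of_le hψ hab hc' hb)
    · obtain ⟨c', hc1, rfl⟩ := intermediate_value_Ioo hab.le ψ.continuous.continuousOn ⟨hc', hc⟩
      exact (ih a' c' hc1.1 ha le_rfl).tail (h.comp_of_le hψ hc1.2 le_rfl hb)

theorem IsDirected.comp {X : MdTop.{u}} {γ : C(I, X.carrier)} (h : X.IsDirected γ) {φ : C(I, I)}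
    (hφ : IsReparam φ) : X.IsDirected (γ.comp φ) := by
  obtain ⟨x, rfl⟩ | h := h
  · exact Or.inl ⟨x, rfl⟩
  · exact Or.inr (transGen_comp hφ h 0 1 zero_lt_one (φ 0).2.1 (φ 1).2.2)

theorem IsPiece.map {X Y : MdTop.{u}} (f : X ⟶ Y) {γ : C(I, X.carrier)} {a b : I}
    (h : X.IsPiece γ a b) : Y.IsPiece (f.toMap.comp γ) a b := by
  obtain ⟨hab, e, he, φ, hφ, heq⟩ := h
  exact ⟨hab, _, f.map_paths e he, φ, hφ, congrArg f.toMap.comp heq⟩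

theorem transGen_map {X Y : MdTop.{u}} (f : X ⟶ Y) {γ : C(I, X.carrier)} {a b : I}
    (h : Relation.TransGen (X.IsPiece γ) a b) :
    Relation.TransGen (Y.IsPiece (f.toMap.comp γ)) a b :=
  h.lift id fun _ _ hp => hp.map f

theorem IsDirected.map {X Y : MdTop.{u}} (f : X ⟶ Y) {γ : C(I, X.carrier)} (h : X.IsDirected γ) :
    Y.IsDirected (f.toMap.comp γ) := by
  obtain ⟨x, rfl⟩ | h := h
  · exact Or.inl ⟨f.toMap x, rfl⟩
  · exact Or.inr (transGen_map f h)

/-- The multipointed `d`-space `A` with the elements of `T` as additional states and with all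
compositions of pieces of `A` between states as execution paths. It has the same directed paths
as `A`, and is a convenient target for maps out of a subdivision of `A`. -/
def saturation (A : MdTop.{u}) (T : Set A.carrier) : MdTop.{u} where
  carrier := A.carrier
  states := A.states ∪ T
  paths := {γ : C(I, A.carrier) | γ 0 ∈ A.states ∪ T ∧ γ 1 ∈ A.states ∪ T ∧
    Relation.TransGen (A.IsPiece γ) 0 1}
  source_mem _ h := h.1
  target_mem _ h := h.2.1
  comp_mem := by
    rintro γ ⟨h0, h1, h⟩ φ hφ
    refine ⟨?_, ?_, transGen_comp hφ.1 h 0 1 zero_lt_one (φ 0).2.1 (φ 1).2.2⟩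
    · rwa [ContinuousMap.comp_apply, hφ.map_zero]
    · rwa [ContinuousMap.comp_apply, hφ.map_one]
  normComp_mem := by
    rintro γ₁ ⟨h0, -, h⟩ γ₂ ⟨-, h1, h'⟩ e
    refine ⟨?_, ?_, transGen_normComp e h h'⟩
    · rwa [show (normComp γ₁ γ₂ e) 0 = γ₁ 0 from Path.source _]
    · rwa [show (normComp γ₁ γ₂ e) 1 = γ₂ 1 from Path.target _]

/-- The map from `A` to its saturation, the identity on underlying spaces. -/
def toSaturation (A : MdTop.{u}) (T : Set A.carrier) : A ⟶ A.saturation T where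
  toMap := ContinuousMap.id _
  map_states _ h := Or.inl h
  map_paths γ h := ⟨Or.inl (A.source_mem γ h), Or.inl (A.target_mem γ h),
    .single ⟨zero_lt_one, γ, h, ContinuousMap.id I, monotone_id,
      by rw [seg_zero_one]; rfl⟩⟩

theorem isDirected_of_saturation {A : MdTop.{u}} {T : Set A.carrier} {γ : C(I, A.carrier)}
    (h : (A.saturation T).IsDirected γ) : A.IsDirected γ := by
  obtain h | h := h
  · exact Or.inl h
  have step : ∀ a b, (A.saturation T).IsPiece γ a b → Relation.TransGen (A.IsPiece γ) a b := by
    rintro a b ⟨hab, e, ⟨-, -, he⟩, φ, hφ, heq⟩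
    have h1 := transGen_comp hφ he 0 1 zero_lt_one (φ 0).2.1 (φ 1).2.2
    have h2 := h1.lift (p := A.IsPiece γ) (seg a b) fun c d hp => hp.affine hab heq
    change Relation.TransGen _ (seg a b 0) (seg a b 1) at h2
    rwa [seg_zero, seg_one] at h2
  exact Or.inr (h.lift' id step)

end MdTop

open MdTop

/-- If `X` is obtained from `A` by subdividing a globe along `F`, then `f : A → X` has an inverse
on underlying spaces, which sends states to states of `A` or points of the image of `F`, and
execution paths to directed paths. -/
theorem exists_inverse_of_isPushout {Z : Type u} [TopologicalSpace Z] {F : Set (Globe Z)}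
    {A X : MdTop.{u}} {g : glob Z ⟶ A} {f : A ⟶ X} {g' : globSub Z F ⟶ X}
    (sq : IsPushout g (globSbd Z F) f g') :
    ∃ r : X ⟶ A.saturation (g.toMap '' F),
      r.toMap.comp f.toMap = ContinuousMap.id _ ∧
      f.toMap.comp (r.toMap : C(X.carrier, A.carrier)) = ContinuousMap.id _ := by
  let k : globSub Z F ⟶ A.saturation (g.toMap '' F) :=
    { toMap := g.toMap
      map_states := by
        rintro x (hx | hx)
        · exact Or.inl (g.map_states x hx)
        · exact Or.inr ⟨x, hx, rfl⟩
      map_paths := by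
        have hs : ∀ x ∈ ({Globe.zero, Globe.one} : Set (Globe Z)) ∪ F,
            g.toMap x ∈ A.states ∪ g.toMap '' F := by
          rintro x (hx | hx)
          · exact Or.inl (g.map_states x hx)
          · exact Or.inr ⟨x, hx, rfl⟩
        rintro γ ⟨h0, h1, hne, hd⟩
        exact ⟨hs _ h0, hs _ h1, transGen_map g (hd.transGen hne)⟩ }
  obtain ⟨r, hr, hr'⟩ := sq.exists_desc (A.toSaturation _) k rfl
  have e1 : r.toMap.comp f.toMap = ContinuousMap.id _ := congrArg Hom.toMap hr
  have e2 : r.toMap.comp g'.toMap = g.toMap := congrArg Hom.toMap hr'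
  have ew : f.toMap.comp g.toMap = g'.toMap := congrArg Hom.toMap sq.w
  let m : C(X.carrier, X.carrier) := f.toMap.comp (r.toMap : C(X.carrier, A.carrier))
  refine ⟨r, e1, ?_⟩
  -- Both sides are continuous endomaps of `X` which agree on `A` and on the globe.
  have : toCodiscrete m = toCodiscrete (ContinuousMap.id X.carrier) := by
    refine sq.hom_ext (Hom.ext ?_) (Hom.ext ?_)
    · exact congrArg f.toMap.comp e1
    · exact (congrArg f.toMap.comp e2).trans ew
  exact congrArg Hom.toMap this

/-! ### Reparametrizations fixing the origin -/

theorem isStartReparam_id : IsStartReparam (ContinuousMap.id I) :=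
  ⟨monotone_id, rfl, fun _ h0 h1 => ⟨h0.ne', h1.ne⟩⟩

theorem IsStartReparam.pos {φ : C(I, I)} (h : IsStartReparam φ) {t : I} (h0 : 0 < t)
    (h1 : t < 1) : 0 < φ t :=
  lt_of_le_of_ne (φ t).2.1 (h.2.2 t h0 h1).1.symm

theorem IsStartReparam.lt_one {φ : C(I, I)} (h : IsStartReparam φ) {t : I} (h0 : 0 < t)
    (h1 : t < 1) : φ t < 1 :=
  lt_of_le_of_ne (φ t).2.2 (h.2.2 t h0 h1).2

theorem IsStartReparam.comp {φ ψ : C(I, I)} (hφ : IsStartReparam φ) (hψ : IsStartReparam ψ) :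
    IsStartReparam (φ.comp ψ) :=
  ⟨hφ.1.comp hψ.1, (congrArg φ hψ.2.1).trans hφ.2.1,
    fun _ h0 h1 => hφ.2.2 _ (hψ.pos h0 h1) (hψ.lt_one h0 h1)⟩

theorem coe_seg_zero_left (ε t : I) : (seg 0 ε t : ℝ) = t * ε := by
  change (Set.Icc.convexComb 0 ε t : ℝ) = _
  rw [Set.Icc.coe_convexComb]
  simp

theorem seg_zero_mem_Icc (ε t : I) : seg 0 ε t ∈ Set.Icc 0 ε :=
  ⟨(seg 0 ε t).2.1, by
    rw [← Subtype.coe_le_coe, coe_seg_zero_left]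
    exact mul_le_of_le_one_left ε.2.1 t.2.2⟩

theorem isStartReparam_seg {ε : I} (hε : 0 < ε) : IsStartReparam (seg 0 ε) := by
  have hε' : (0 : ℝ) < ε := hε
  refine ⟨seg_mono hε.le, seg_zero _ _, fun t h0 h1 => ⟨?_, ?_⟩⟩
  · refine Subtype.coe_ne_coe.1 ?_
    rw [coe_seg_zero_left]
    exact (mul_pos (show (0 : ℝ) < t from h0) hε').ne'
  · refine Subtype.coe_ne_coe.1 (ne_of_lt ?_)
    rw [coe_seg_zero_left]
    have h1' : (t : ℝ) < 1 := h1
    have := ε.2.2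
    change (t : ℝ) * ε < 1
    nlinarith

theorem exists_pos_Icc_subset {V : Set I} (hV : V ∈ 𝓝 (0 : I)) :
    ∃ ε : I, 0 < ε ∧ Set.Icc 0 ε ⊆ V := by
  obtain ⟨u, hu, h⟩ := (mem_nhdsGE_iff_exists_mem_Ioc_Ico_subset (zero_lt_one : (0 : I) < 1)).1
    (mem_nhdsWithin_of_mem_nhds hV)
  obtain ⟨ε, h0, hε⟩ := exists_between hu.1
  exact ⟨ε, h0, (Set.Icc_subset_Ico_right hε).trans h⟩

/-- A reparametrization which fixes the origin factors, near the origin, through a given initial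
segment. -/
theorem IsStartReparam.exists_seg_factor {φ : C(I, I)} (hφ : IsStartReparam φ) {ε : I}
    (hε : 0 < ε) : ∃ (s : I) (ψ : C(I, I)), 0 < s ∧ IsStartReparam ψ ∧
      (seg 0 ε).comp ψ = φ.comp (seg 0 s) := by
  have hnhds : φ ⁻¹' Set.Iio ε ∈ 𝓝 (0 : I) :=
    φ.continuous.continuousAt.preimage_mem_nhds (by rw [hφ.2.1]; exact Iio_mem_nhds hε)
  obtain ⟨s, hs, hsub⟩ := exists_pos_Icc_subset hnhds
  have hfac : ∀ t, seg 0 ε (segInv 0 ε (φ (seg 0 s t))) = φ (seg 0 s t) := fun t =>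
    seg_segInv hε (φ _).2.1 (hsub (seg_zero_mem_Icc s t) : φ _ < ε).le
  refine ⟨s, (segInv 0 ε).comp (φ.comp (seg 0 s)), hs, ⟨?_, ?_, fun t h0 h1 => ⟨?_, ?_⟩⟩, ?_⟩
  · exact (segInv_mono hε).comp (hφ.1.comp (seg_mono hs.le))
  · simp [ContinuousMap.comp_apply, hφ.2.1, segInv]
  · intro h
    have := hfac t
    rw [show segInv 0 ε (φ (seg 0 s t)) = 0 from h, seg_zero] at this
    exact ((hφ.comp (isStartReparam_seg hs)).pos h0 h1).ne this
  · intro h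
    have := hfac t
    rw [show segInv 0 ε (φ (seg 0 s t)) = 1 from h, seg_one] at this
    exact (hsub (seg_zero_mem_Icc s t) : φ _ < ε).ne this.symm
  · ext t
    exact congrArg Subtype.val (hfac t)

/-! ### Germs of short directed paths -/

namespace MdTop

theorem comp_mem_shortPaths {X : MdTop.{u}} {α : X.carrier} {γ : C(I, X.carrier)}
    (h : γ ∈ X.shortPaths α) {φ : C(I, I)} (hφ : IsStartReparam φ) :
    γ.comp φ ∈ X.shortPaths α :=
  ⟨h.1.comp hφ.1, (congrArg γ hφ.2.1).trans h.2.1,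
    fun _ h0 h1 => h.2.2 _ (hφ.pos h0 h1) (hφ.lt_one h0 h1)⟩

theorem ShortPath.toMap_mem {X : MdTop.{u}} {α : X.carrier} (γ : X.ShortPath α) :
    γ.toMap ∈ X.shortPaths α :=
  (WithGeneratedByTopology.equiv γ).2

theorem germ_congr {X : MdTop.{u}} {α : X.carrier} {γ γ' : C(I, X.carrier)} (e : γ = γ')
    (h : γ ∈ X.shortPaths α) (h' : γ' ∈ X.shortPaths α) : X.germ α γ h = X.germ α γ' h' := by
  subst e
  rfl

theorem germ_comp {X : MdTop.{u}} {α : X.carrier} {γ : C(I, X.carrier)}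
    (h : γ ∈ X.shortPaths α) {φ : C(I, I)} (hφ : IsStartReparam φ) :
    X.germ α (γ.comp φ) (comp_mem_shortPaths h hφ) = X.germ α γ h :=
  Quot.sound ⟨ShortPath.mk γ h, φ, ContinuousMap.id I, hφ, isStartReparam_id, rfl, rfl⟩

/-- If a path, not necessarily short, becomes short after restriction to an initial segment and
after some other reparametrization fixing the origin, then the two germs coincide. -/
theorem germ_comp_eq_germ_comp_seg {X : MdTop.{u}} {α : X.carrier} {γ : C(I, X.carrier)}
    {φ : C(I, I)} (hφ : IsStartReparam φ) (h : γ.comp φ ∈ X.shortPaths α) {ε : I} (hε : 0 < ε)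
    (h' : γ.comp (seg 0 ε) ∈ X.shortPaths α) :
    X.germ α _ h = X.germ α _ h' := by
  obtain ⟨s, ψ, hs, hψ, e⟩ := hφ.exists_seg_factor hε
  rw [← germ_comp h (isStartReparam_seg hs), ← germ_comp h' hψ]
  exact germ_congr (by rw [ContinuousMap.comp_assoc, ContinuousMap.comp_assoc, e]) _ _

end MdTop

/-! ### Comparison of the branching spaces -/

section Comparison

variable {A X : MdTop.{u}} {α : A.carrier} {T : Set A.carrier} {f : C(A.carrier, X.carrier)}

/-- The composition with `f` identifies the short directed paths of `X` from `f α` with those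
short directed paths of `A` from `α` which avoid `T`. -/
def IsShortPathRestriction (A X : MdTop.{u}) (α : A.carrier) (T : Set A.carrier)
    (f : C(A.carrier, X.carrier)) : Prop :=
  ∀ γ : C(I, A.carrier), f.comp γ ∈ X.shortPaths (f α) ↔
    γ ∈ A.shortPaths α ∧ ∀ t, 0 < t → t < 1 → γ t ∉ T

/-- The short directed paths of `A` whose restriction to `[0,ε]` avoids `T \ {α}`. -/
def avoiding (A : MdTop.{u}) (α : A.carrier) (T : Set A.carrier) (ε : I) :
    Set (A.ShortPath α) :=
  {γ | Set.MapsTo γ.toMap (Set.Icc 0 ε) (T \ {α})ᶜ}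

theorem isOpen_avoiding [T1Space A.carrier] (hT : T.Finite) (ε : I) :
    IsOpen (avoiding A α T ε) := by
  have h : IsOpen {γ : C(I, A.carrier) | Set.MapsTo γ (Set.Icc 0 ε) (T \ {α})ᶜ} :=
    ContinuousMap.isOpen_setOfPred_mapsTo isCompact_Icc hT.sdiff.isClosed.isOpen_compl
  exact h.preimage (continuous_subtype_val.comp WithGeneratedByTopology.continuous_equiv)

theorem exists_mem_avoiding [T1Space A.carrier] (hT : T.Finite) (γ : A.ShortPath α) :
    ∃ ε : I, 0 < ε ∧ γ ∈ avoiding A α T ε := by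
  refine exists_pos_Icc_subset (V := γ.toMap ⁻¹' (T \ {α})ᶜ)
    (γ.toMap.continuous.continuousAt.preimage_mem_nhds ?_)
  refine hT.sdiff.isClosed.isOpen_compl.mem_nhds ?_
  rw [γ.toMap_mem.2.1]
  exact fun h => h.2 rfl

theorem comp_seg_mem_shortPaths (hα : α ∈ A.states) (hf : IsShortPathRestriction A X α T f)
    {ε : I} (hε : 0 < ε) {γ : A.ShortPath α} (h : γ ∈ avoiding A α T ε) :
    f.comp (γ.toMap.comp (seg 0 ε)) ∈ X.shortPaths (f α) := by
  have hs := comp_mem_shortPaths γ.toMap_mem (isStartReparam_seg hε)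
  refine (hf _).2 ⟨hs, fun t h0 h1 hT => ?_⟩
  exact h (seg_zero_mem_Icc ε t) ⟨hT, fun e => hs.2.2 t h0 h1 (e.symm ▸ hα)⟩

theorem exists_comp_seg_mem_shortPaths [T1Space A.carrier] (hT : T.Finite) (hα : α ∈ A.states)
    (hf : IsShortPathRestriction A X α T f) (γ : A.ShortPath α) :
    ∃ ε : I, 0 < ε ∧ f.comp (γ.toMap.comp (seg 0 ε)) ∈ X.shortPaths (f α) := by
  obtain ⟨ε, hε, h⟩ := exists_mem_avoiding hT γ
  exact ⟨ε, hε, comp_seg_mem_shortPaths hα hf hε h⟩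

/-- The class in the branching space of `X` of a small initial segment of a short directed path
of `A`. -/
noncomputable def initialGerm [T1Space A.carrier] (hT : T.Finite) (hα : α ∈ A.states)
    (hf : IsShortPathRestriction A X α T f) (γ : A.ShortPath α) : X.Branching (f α) :=
  X.germ (f α) _ (exists_comp_seg_mem_shortPaths hT hα hf γ).choose_spec.2

theorem initialGerm_eq [T1Space A.carrier] (hT : T.Finite) (hα : α ∈ A.states)
    (hf : IsShortPathRestriction A X α T f) (γ : A.ShortPath α) {φ : C(I, I)}
    (hφ : IsStartReparam φ) (h : f.comp (γ.toMap.comp φ) ∈ X.shortPaths (f α)) :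
    initialGerm hT hα hf γ = X.germ (f α) _ h :=
  (germ_comp_eq_germ_comp_seg (γ := f.comp γ.toMap) hφ h
    (exists_comp_seg_mem_shortPaths hT hα hf γ).choose_spec.1 _).symm

/-- On each of the open sets `avoiding A α T ε`, the restriction to `[0,ε]` is a continuous map to
the short directed paths of `X`. -/
theorem continuous_initialGerm [T1Space A.carrier] (hT : T.Finite) (hα : α ∈ A.states)
    (hf : IsShortPathRestriction A X α T f) : Continuous (initialGerm hT hα hf) := by
  rw [continuous_iff_continuousAt]
  intro γ
  obtain ⟨ε, hε, hγ⟩ := exists_mem_avoiding hT γ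
  have hU := isOpen_avoiding (α := α) hT ε
  have := hU.isGeneratedBy (X := fun n : ℕ => Fin n → ℝ)
  refine ContinuousOn.continuousAt ?_ (hU.mem_nhds hγ)
  rw [continuousOn_iff_continuous_domRestrict]
  let r : avoiding A α T ε → X.shortPaths (f α) :=
    fun γ => ⟨_, comp_seg_mem_shortPaths hα hf hε γ.2⟩
  have hr : Continuous r := by
    refine Continuous.subtype_mk ((ContinuousMap.continuous_postcomp f).comp
      ((ContinuousMap.continuous_precomp (seg 0 ε)).comp ?_)) _
    exact continuous_subtype_val.comp
      (WithGeneratedByTopology.continuous_equiv.comp continuous_subtype_val)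
  have hr' := (IsGeneratedBy.equiv_symm_comp_continuous_iff (X := fun n : ℕ => Fin n → ℝ) r).2 hr
  convert continuous_quot_mk.comp hr' using 1
  funext γ
  exact initialGerm_eq hT hα hf γ.1 (isStartReparam_seg hε) _

theorem initialGerm_eq_of_germRel [T1Space A.carrier] (hT : T.Finite) (hα : α ∈ A.states)
    (hf : IsShortPathRestriction A X α T f) {γ₁ γ₂ : A.ShortPath α} (h : A.GermRel α γ₁ γ₂) :
    initialGerm hT hα hf γ₁ = initialGerm hT hα hf γ₂ := by
  obtain ⟨γ, φ₁, φ₂, h1, h2, e1, e2⟩ := h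
  have key : ∀ (δ : A.ShortPath α) (φ : C(I, I)), IsStartReparam φ → γ.toMap.comp φ = δ.toMap →
      initialGerm hT hα hf δ = initialGerm hT hα hf γ := by
    intro δ φ hφ e
    obtain ⟨ε, hε, h⟩ := exists_comp_seg_mem_shortPaths hT hα hf δ
    have e' : f.comp (δ.toMap.comp (seg 0 ε)) = f.comp (γ.toMap.comp (φ.comp (seg 0 ε))) := by
      rw [← e, ContinuousMap.comp_assoc]
    rw [initialGerm_eq hT hα hf δ (isStartReparam_seg hε) h, initialGerm_eq hT hα hf γ
      (hφ.comp (isStartReparam_seg hε)) (e' ▸ h)]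
    exact germ_congr e' _ _
  rw [key _ _ h1 e1, key _ _ h2 e2]

variable {r : C(X.carrier, A.carrier)}

theorem comp_inverse_mem_shortPaths (hf : IsShortPathRestriction A X α T f)
    (hfr : f.comp r = ContinuousMap.id _) {δ : C(I, X.carrier)}
    (h : δ ∈ X.shortPaths (f α)) : r.comp δ ∈ A.shortPaths α := by
  refine ((hf _).1 ?_).1
  rwa [← ContinuousMap.comp_assoc, hfr, ContinuousMap.id_comp]

/-- The map of branching spaces induced by the inverse of `f`. -/
def branchingInverse (hf : IsShortPathRestriction A X α T f)
    (hfr : f.comp r = ContinuousMap.id _) : X.Branching (f α) → A.Branching α :=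
  Quot.map (fun δ => ShortPath.mk _ (comp_inverse_mem_shortPaths hf hfr δ.toMap_mem)) (by
    rintro δ₁ δ₂ ⟨δ, φ₁, φ₂, h1, h2, e1, e2⟩
    exact ⟨ShortPath.mk _ (comp_inverse_mem_shortPaths hf hfr δ.toMap_mem), φ₁, φ₂, h1, h2,
      congrArg r.comp e1, congrArg r.comp e2⟩)

theorem continuous_branchingInverse (hf : IsShortPathRestriction A X α T f)
    (hfr : f.comp r = ContinuousMap.id _) : Continuous (branchingInverse hf hfr) := by
  refine continuous_quot_lift _ (continuous_quot_mk.comp ?_)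
  refine (IsGeneratedBy.equiv_symm_comp_continuous_iff (X := fun n : ℕ => Fin n → ℝ)
    (fun δ : X.ShortPath (f α) => (⟨r.comp δ.toMap,
      comp_inverse_mem_shortPaths hf hfr δ.toMap_mem⟩ : A.shortPaths α))).2 ?_
  exact Continuous.subtype_mk ((ContinuousMap.continuous_postcomp r).comp
    (continuous_subtype_val.comp WithGeneratedByTopology.continuous_equiv)) _

/-- The homeomorphism of branching spaces which sends the class of a short directed path of `A` to
the class in `X` of a small initial segment. -/
noncomputable def branchingHomeomorph [T1Space A.carrier] (hT : T.Finite) (hα : α ∈ A.states)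
    (hf : IsShortPathRestriction A X α T f) (hrf : r.comp f = ContinuousMap.id _)
    (hfr : f.comp r = ContinuousMap.id _) : A.Branching α ≃ₜ X.Branching (f α) where
  toFun := Quot.lift (initialGerm hT hα hf) fun _ _ => initialGerm_eq_of_germRel hT hα hf
  invFun := branchingInverse hf hfr
  left_inv := by
    rintro ⟨γ⟩
    obtain ⟨ε, hε, h⟩ := exists_comp_seg_mem_shortPaths hT hα hf γ
    change branchingInverse hf hfr (initialGerm hT hα hf γ) = A.germ α γ.toMap γ.toMap_mem
    rw [initialGerm_eq hT hα hf γ (isStartReparam_seg hε) h,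
      ← germ_comp γ.toMap_mem (isStartReparam_seg hε)]
    refine germ_congr (γ := r.comp (f.comp (γ.toMap.comp (seg 0 ε)))) ?_ _ _
    rw [← ContinuousMap.comp_assoc, hrf, ContinuousMap.id_comp]
  right_inv := by
    rintro ⟨δ⟩
    have e : f.comp ((r.comp δ.toMap).comp (ContinuousMap.id I)) = δ.toMap := by
      rw [ContinuousMap.comp_id, ← ContinuousMap.comp_assoc, hfr, ContinuousMap.id_comp]
    refine (initialGerm_eq hT hα hf _ isStartReparam_id (e.symm ▸ δ.toMap_mem)).trans ?_
    exact germ_congr e _ δ.toMap_mem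
  continuous_toFun := continuous_quot_lift _ (continuous_initialGerm hT hα hf)
  continuous_invFun := continuous_branchingInverse hf hfr

end Comparison

/-- A map `f : A → X` with an inverse as in `exists_inverse_of_isPushout` adds the elements of `T`
to the states, but no directed path. -/
theorem isShortPathRestriction_of_inverse {A X : MdTop.{u}} {T : Set A.carrier} {f : A ⟶ X}
    {r : X ⟶ A.saturation T} (hrf : r.toMap.comp f.toMap = ContinuousMap.id _)
    (hT : ∀ x ∈ T, f.toMap x ∈ X.states) (α : A.carrier) :
    IsShortPathRestriction A X α T f.toMap := by
  have hr : ∀ x, (r.toMap (f.toMap x) : A.carrier) = x := fun x => congrArg (fun k => k x) hrf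
  have hst : ∀ x, f.toMap x ∈ X.states ↔ x ∈ A.states ∪ T := fun x =>
    ⟨fun h => (congrArg (· ∈ A.states ∪ T) (hr x)).mp (r.map_states _ h),
      fun h => h.elim (f.map_states x) (hT x)⟩
  have hd : ∀ γ, X.IsDirected (f.toMap.comp γ) ↔ A.IsDirected γ := fun γ =>
    ⟨fun h => by
      have := isDirected_of_saturation (h.map r)
      have e : r.toMap.comp (f.toMap.comp γ) = γ := congrArg (fun k => k.comp γ) hrf
      rwa [e] at this, fun h => h.map f⟩
  have hα : ∀ x, f.toMap x = f.toMap α ↔ x = α :=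
    fun x => ⟨fun h => by rw [← hr x, h, hr], fun h => h ▸ rfl⟩
  intro γ
  simp only [shortPaths, Set.mem_ofPred_eq, hd, ContinuousMap.comp_apply, hα, hst, Set.mem_union,
    not_or]
  grind

end DirTop

theorem proposition6p8 (n : ℕ)
    (F : Set (DirTop.Globe (TopCat.disk.{u} n))) (hF : F.Finite)
    (hFS : Disjoint F (Set.range (DirTop.Globe.map (DirTop.sphereIncl.{u} n))))
    {A X : DirTop.MdTop.{u}} (hA : DirTop.IsCellular A)
    (g : DirTop.glob (TopCat.disk.{u} n) ⟶ A) (f : A ⟶ X)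
    (g' : DirTop.globSub (TopCat.disk.{u} n) F ⟶ X)
    (hpush : IsPushout g (DirTop.globSbd (TopCat.disk.{u} n) F) f g')
    (α : A.carrier) (hα : α ∈ A.states) :
    (∀ γ ∈ A.shortPaths α, ∃ φ : C(I, I), DirTop.IsStartReparam φ ∧
      γ.comp φ ∈ A.shortPaths α ∧
      f.toMap.comp (γ.comp φ) ∈ X.shortPaths (f.toMap α)) ∧
    ∃! H : A.Branching α ≃ₜ X.Branching (f.toMap α),
      ∀ (γ : C(I, A.carrier)) (h : γ ∈ A.shortPaths α)
        (h' : f.toMap.comp γ ∈ X.shortPaths (f.toMap α)),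
        H (A.germ α γ h) = X.germ (f.toMap α) (f.toMap.comp γ) h' := by
  have := hA.t1Space
  obtain ⟨r, hrf, hfr⟩ := DirTop.exists_inverse_of_isPushout hpush
  have hT : (g.toMap '' F).Finite := hF.image _
  have hs : DirTop.IsShortPathRestriction A X α (g.toMap '' F) f.toMap := by
    refine DirTop.isShortPathRestriction_of_inverse hrf ?_ α
    rintro _ ⟨x, hx, rfl⟩
    have e : f.toMap.comp g.toMap = g'.toMap := congrArg DirTop.MdTop.Hom.toMap hpush.w
    have := g'.map_states x (Or.inr hx)
    rwa [← e] at this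
  have hseg := DirTop.exists_comp_seg_mem_shortPaths hT hα hs
  refine ⟨fun γ hγ => ?_, existsUnique_of_exists_of_unique
    ⟨DirTop.branchingHomeomorph hT hα hs hrf hfr, fun γ h h' => ?_⟩ fun H H' hH hH' => ?_⟩
  · obtain ⟨ε, hε, h⟩ := hseg (DirTop.MdTop.ShortPath.mk γ hγ)
    exact ⟨_, DirTop.isStartReparam_seg hε,
      DirTop.MdTop.comp_mem_shortPaths hγ (DirTop.isStartReparam_seg hε), h⟩
  · exact DirTop.initialGerm_eq hT hα hs (DirTop.MdTop.ShortPath.mk γ h)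
      DirTop.isStartReparam_id h'
  · ext x
    obtain ⟨γ, rfl⟩ := Quot.exists_rep x
    obtain ⟨ε, hε, h⟩ := hseg γ
    change H (A.germ α γ.toMap γ.toMap_mem) = H' (A.germ α γ.toMap γ.toMap_mem)
    rw [← DirTop.MdTop.germ_comp γ.toMap_mem (DirTop.isStartReparam_seg hε), hH _ _ h, hH' _ _ h]
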